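/- \textbf{Setting.} Consider a DC microgrid with $N$ distributed generators (DGs) and $L$ lines. Line $l$ is oriented from one DG to a different one; $\mathcal B\in\mathbb R^{N\times L}$ has $\mathcal B_{il}=1$ if $l$ leaves $i$, $-1$ if $l$ enters $i$, and $0$ otherwise. The parameters $C_{ti},L_{ti},R_{ti}$ (capacitance, inductance, resistance), the power ratings $P_{ni}$, the reference voltages $V_{ri}$ and the line data $R_l,L_l$ are positive; $Y_{Li},P_{Li}$ are the load conductance and constant load power, $k^P_{i0},k^I_{i0}$ the local PI gains, $K_{aw,i}$ the anti-windup gain, $I_s$ the current sharing ratio, and $\phi_i(u)=\mathrm{sat}_i(u)-u$ the dead-zone function of the saturation with limits $V_{ti}^{\min},V_{ti}^{\max}$. \emph{Error subsystems.} With $\tilde x_i=(\tilde V_i,\tilde I_{ti},\tilde v_i)\in\mathbb R^3$, the DG error subsystem is $$\dot{\tilde x}_i=(A_i+B_iK_{i0})\tilde x_i+g_i(\tilde x_i)+B_i^{aw}\phi_i(u_i)+\tilde\eta_i,\qquad u_i=V_{ri}+R_{ti}P_{ni}I_s+K_{i0}\tilde x_i+u_{iG},$$ $$A_i=\begin{bmatrix}-Y_{Li}/C_{ti}&1/C_{ti}&0\\-1/L_{ti}&-R_{ti}/L_{ti}&0\\1&0&0\end{bmatrix},\quad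 B_i=\begin{bmatrix}0\\1/L_{ti}\\0\end{bmatrix},\quad B_i^{aw}=\begin{bmatrix}0\\1/L_{ti}\\-K_{aw,i}\end{bmatrix},\quad K_{i0}=[k^P_{i0}\ \ 0\ \ k^I_{i0}],$$ and $g_i(\tilde x_i)=\big(\tfrac{P_{Li}}{C_{ti}}(\tfrac1{V_{ri}}-\tfrac1{\tilde V_i+V_{ri}}),0,0\big)^\top$. The line error subsystem is $\dot{\tilde{\bar x}}_l=-\tfrac{R_l}{L_l}\tilde{\bar x}_l+b_l\tilde{\bar u}_l$ with a real input gain $b_l$. The consensus controller with in-neighbour sets $\mathcal F_i^-\subseteq\{1,\dots,N\}\setminus\{i\}$ and gains $k^c_{ij}$, where $k^c_{ij}\neq0$ if and only if $j\in\mathcal F_i^-$, is $u_{iG}=\sum_{j\in\mathcal F_i^-}k^c_{ij}(\tilde I_{ti}/P_{ni}-\tilde I_{tj}/P_{nj})$. Its gain matrix is $K=[K_{ij}]$, where $K_{ij}\in\mathbb R^{3\times3}$ has the single possibly nonzero entry $[K_I]_{ij}/L_{ti}$ at position $(2,2)$, with $[K_I]_{ii}=\sum_{j\in\mathcal F_i^-}k^c_{ij}/P_{ni}$,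 $[K_I]_{ij}=-k^c_{ij}/P_{nj}$ for $j\in\mathcal F_i^-$, and $[K_I]_{ij}=0$ otherwise. \emph{Networked error system.} With stacked vectors, $w_c=(w,\bar w)$ and $z_c=(z,\bar z)$, $$\tilde\eta=K\tilde x+\bar C\tilde{\bar x}+E_cw_c,\qquad \tilde{\bar u}=C\tilde x+\bar E_cw_c,\qquad z_c=H_c\tilde x+\bar H_c\tilde{\bar x},$$ where $\bar C_{il}=-C_{ti}^{-1}[\mathcal B_{il}\ 0\ 0]^\top$, $C_{il}=[\mathcal B_{il}\ 0\ 0]$ is the $(l,i)$ block of $C$, $E_c=[\,\mathrm{diag}_i(\mathrm{diag}(C_{ti}^{-1},L_{ti}^{-1},1))\ \ \mathbf 0\,]$, $\bar E_c=[\,\mathbf 0\ \ \mathrm{diag}_l(\bar e_l)\,]$ with real $\bar e_l$ (for example $b_l=1,\ \bar e_l=1/L_l$, or $b_l=1/L_l,\ \bar e_l=1$), $H_c=\begin{bmatrix}\mathrm{diag}(H_i)\\ \mathbf 0\end{bmatrix}$, and $\bar H_c=\begin{bmatrix}\mathbf 0\\ \mathrm{diag}(\bar H_l)\end{bmatrix}$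 with arbitrary $H_i,\bar H_l$. \emph{Dissipativity.} A system $\dot x=f(x,u)$, $y=h(x,u)$ is dissipative under the supply rate $s$ on a set $D$ of pairs $(x,u)$ if there is a $C^1$ function $V$ with $V(0)=0$, $V(x)>0$ for $x\ne0$, and $\nabla V(x)f(x,u)\le s(u,h(x,u))$ for all $(x,u)\in D$. It is IF-OFP$(\nu,\rho)$ if $s(u,y)=-\nu|u|^2+u^\top y-\rho|y|^2$. \textbf{Assumption.} For sets $\mathcal X_i\subseteq\mathbb R^3$ (operating ranges; $\mathcal X_i=\mathbb R^3$ is allowed) and bounds $\bar\delta_i$, each DG error subsystem $\tilde\eta_i\mapsto\tilde x_i$ is IF-OFP$(\nu_i,\rho_i)$ for all $\tilde x_i\in\mathcal X_i$, all $\tilde\eta_i\in\mathbb R^3$ and all unknown $u_{iG}$ with $|u_{iG}|\le\bar\delta_i$; each line error subsystem $\tilde{\bar u}_l\mapsto\tilde{\bar x}_l$ is IF-OFP$(\bar\nu_l,\bar\rho_l)$ globally. \textbf{LMI problem.} Let $\mathbf X_p^{11}=\mathrm{diag}(-p_i\nu_i\mathbf I_3)$, $\mathbf X_p^{22}=\mathrm{diag}(-p_i\rho_i\mathbf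 I_3)$, $\mathbf X^{12}=\mathrm{diag}(-\tfrac1{2\nu_i}\mathbf I_3)$, $\mathbf X^{21}=(\mathbf X^{12})^\top$, and analogously $\bar{\mathbf X}_{\bar p}^{11}=\mathrm{diag}(-\bar p_l\bar\nu_l)$, $\bar{\mathbf X}_{\bar p}^{22}=\mathrm{diag}(-\bar p_l\bar\rho_l)$, $\bar{\mathbf X}^{12}=\mathrm{diag}(-\tfrac1{2\bar\nu_l})$, $\bar{\mathbf X}^{21}=(\bar{\mathbf X}^{12})^\top$. Let $$W=\begin{bmatrix} \mathbf X_p^{11}&0&0&Q&\mathbf X_p^{11}\bar C&\mathbf X_p^{11}E_c\\ 0&\bar{\mathbf X}_{\bar p}^{11}&0&\bar{\mathbf X}_{\bar p}^{11}C&0&\bar{\mathbf X}_{\bar p}^{11}\bar E_c\\ 0&0&\mathbf I&H_c&\bar H_c&0\\ \star&\star&\star&-Q^\top\mathbf X^{12}-\mathbf X^{21}Q-\mathbf X_p^{22}&-\mathbf X^{21}\mathbf X_p^{11}\bar C-C^\top\bar{\mathbf X}_{\bar p}^{11}\bar{\mathbf X}^{12}&-\mathbf X^{21}\mathbf X_p^{11}E_c\\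 \star&\star&\star&\star&-\bar{\mathbf X}_{\bar p}^{22}&-\bar{\mathbf X}^{21}\bar{\mathbf X}_{\bar p}^{11}\bar E_c\\ \star&\star&\star&\star&\star&\tilde\gamma\mathbf I \end{bmatrix},$$ where $\star$ denotes the transposed blocks. Let $\bar\gamma,\eta\in\mathbb R$, and let $(Q,\{p_i\},\{\bar p_l\},\tilde\gamma,S)$ be any feasible point of the co-design problem with the constraints $$p_i>0,\quad \bar p_l>0,\quad W>0,\quad W+S>0,\quad S\ge0,\quad \mathrm{tr}(S)\le\eta,\quad 0<\tilde\gamma<\bar\gamma,\quad Q_IP_n\mathbf 1_N=0,$$ where each $3\times3$ block $Q_{ij}$ vanishes outside its $(2,2)$ entry, $Q_I=[Q_{ij}^{2,2}]_{i,j}$ and $P_n=\mathrm{diag}(P_{ni})$. (Feasibility is all that is used, so the statement applies in particular to every point found by minimizing $\sum_{i,j}c_{ij}\|Q_{ij}\|_1+c_1\tilde\gamma+\alpha\,\mathrm{tr}(S)$ under these constraints.) \textbf{Theorem.} There is exactly one consensus controller, that is, one communication topology $(\mathcal F_i^-)_i$ with gains $(k^c_{ij})$, whose gain matrix is $K=(\mathbf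 X_p^{11})^{-1}Q$. Its links are given by $j\in\mathcal F_i^-$ if and only if $i\ne j$ and $K_{ij}\ne0$, and $K_IP_n\mathbf 1_N=0$. Put $\gamma=\sqrt{\tilde\gamma}$, so that $\gamma^2=\tilde\gamma<\bar\gamma$. On the operating range $\{\tilde x_i\in\mathcal X_i,\ |u_{iG}|\le\bar\delta_i\ \text{for all } i\}$, the networked error system closed with this controller is dissipative under the supply rate $\gamma^2|w_c|^2-|z_c|^2$, and it is finite-gain $L_2$-stable with gain $\gamma$ from $w_c$ to $z_c$: there is a function $\beta\ge0$ of the state with $\beta(0)=0$ such that, for every $T\ge0$, every $w_c\in L_2([0,T])$ and every absolutely continuous solution that stays in the operating range on $[0,T]$, $$\int_0^T|z_c|^2\,dt\le\gamma^2\int_0^T|w_c|^2\,dt+\beta(\text{initial state}).$$ -/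

import Mathlib

open Matrix MeasureTheory

noncomputable section

namespace DCMG

/-! ### Dissipativity and finite-gain `L₂` stability

A system `ẋ = f(x,u)`, `y = h(x,u)` is considered on a set `D` of admissible pairs
(state, input); `D = Set.univ` is the global notion. -/

section Systems

variable {X U Y : Type*} [NormedAddCommGroup X] [NormedSpace ℝ X]

/-- Dissipativity under the supply rate `s` on `D`: there is a continuously differentiable,
positive definite storage function `V` with `∇V(x) f(x,u) ≤ s(u, h(x,u))` on `D`. -/
def DissipativeOn (D : Set (X × U)) (f : X → U → X) (h : X → U → Y) (s : U → Y → ℝ) : Prop :=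
  ∃ V : X → ℝ, ContDiff ℝ 1 V ∧ V 0 = 0 ∧ (∀ x, x ≠ 0 → 0 < V x) ∧
    ∀ x u, (x, u) ∈ D → fderiv ℝ V x (f x u) ≤ s u (h x u)

/-- Carathéodory solutions of `ẋ = f(x,u)` on `[0,T]` that remain in `D`. -/
structure IsTrajectoryOn (D : Set (X × U)) (f : X → U → X) (u : ℝ → U) (x : ℝ → X)
    (T : ℝ) : Prop where
  absCont : AbsolutelyContinuousOnInterval x 0 T
  ode : ∀ᵐ t ∂(volume.restrict (Set.Icc 0 T)), HasDerivAt x (f (x t) (u t)) t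
  mem : ∀ t ∈ Set.Icc 0 T, (x t, u t) ∈ D

end Systems

/-- The IF-OFP(`ν`,`ρ`) supply rate `[u;y]ᵀ [[-νI, I/2],[I/2, -ρI]] [u;y]`. -/
def ifofpSupply {ι : Type*} [Fintype ι] (ν ρ : ℝ) (u y : ι → ℝ) : ℝ :=
  -ν * (u ⬝ᵥ u) + u ⬝ᵥ y - ρ * (y ⬝ᵥ y)

/-- The supply rate `γ² |w|² - |z|²` (Euclidean norms). -/
def l2Supply {ι κ : Type*} [Fintype ι] [Fintype κ] (γ : ℝ) (w : ι → ℝ) (z : κ → ℝ) : ℝ :=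
  γ ^ 2 * (w ⬝ᵥ w) - z ⬝ᵥ z

/-- Finite `L₂`-gain `γ` along trajectories that remain in `D`: on every interval `[0,T]`, for
every square integrable input, `∫ |z|² ≤ γ² ∫ |w|² + β(x(0))`, where the bias `β ≥ 0` depends
only on the initial state and vanishes at the origin. -/
def HasFiniteL2GainOn {X ι κ : Type*} [NormedAddCommGroup X] [NormedSpace ℝ X]
    [Fintype ι] [Fintype κ] (D : Set (X × (ι → ℝ))) (f : X → (ι → ℝ) → X)
    (h : X → (ι → ℝ) → (κ → ℝ)) (γ : ℝ) : Prop :=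
  ∃ β : X → ℝ, (∀ x, 0 ≤ β x) ∧ β 0 = 0 ∧
    ∀ (T : ℝ) (w : ℝ → ι → ℝ) (x : ℝ → X), 0 ≤ T →
      MemLp w 2 (volume.restrict (Set.Icc 0 T)) →
      IsTrajectoryOn D f w x T →
      ∫ t in Set.Icc 0 T, h (x t) (w t) ⬝ᵥ h (x t) (w t) ≤
        γ ^ 2 * (∫ t in Set.Icc 0 T, w t ⬝ᵥ w t) + β (x 0)

/-! ### The DC microgrid -/

/-- Physical and local control data of a DC microgrid with `N` distributed generators (DGs) and
`L` lines, together with its operating point and its performance outputs. -/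
structure Microgrid (N L : ℕ) where
  /-- the line `l` is oriented from `src l` to `dst l` -/
  src : Fin L → Fin N
  dst : Fin L → Fin N
  src_ne_dst : ∀ l, src l ≠ dst l
  /-- filter capacitance, inductance and resistance of the DGs -/
  Ct : Fin N → ℝ
  Lt : Fin N → ℝ
  Rt : Fin N → ℝ
  Ct_pos : ∀ i, 0 < Ct i
  Lt_pos : ∀ i, 0 < Lt i
  Rt_pos : ∀ i, 0 < Rt i
  /-- conductance of the constant impedance load and power of the constant power load -/
  YL : Fin N → ℝ
  PL : Fin N → ℝ
  /-- power ratings, reference voltages, and current sharing ratio -/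
  Pn : Fin N → ℝ
  Pn_pos : ∀ i, 0 < Pn i
  Vr : Fin N → ℝ
  Vr_pos : ∀ i, 0 < Vr i
  Is : ℝ
  /-- saturation limits of the converters and anti-windup gains -/
  Vtmin : Fin N → ℝ
  Vtmax : Fin N → ℝ
  Kaw : Fin N → ℝ
  /-- gains of the local PI controllers -/
  kP : Fin N → ℝ
  kI : Fin N → ℝ
  /-- resistance and inductance of the lines -/
  Rl : Fin L → ℝ
  Ll : Fin L → ℝ
  Rl_pos : ∀ l, 0 < Rl l
  Ll_pos : ∀ l, 0 < Ll l
  /-- The line error subsystem is `ẋ_l = -(R_l/L_l) x_l + lineGain_l u_l`, where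
  `u_l = Σ_i B_il V_i + lineDist_l w_l`. Both usual normalizations are covered:
  `lineGain = 1, lineDist = 1/L_l` and `lineGain = 1/L_l, lineDist = 1`. -/
  lineGain : Fin L → ℝ
  lineDist : Fin L → ℝ
  /-- local performance outputs `z_i = H_i x_i` and `z_l = Hbar_l x_l` -/
  m : Fin N → ℕ
  mbar : Fin L → ℕ
  H : ∀ i, Matrix (Fin (m i)) (Fin 3) ℝ
  Hbar : ∀ l, Fin (mbar l) → ℝ

/-- Index set of the stacked DG states; component `0` of a DG is the voltage error, `1` the
current error, `2` the integrator error. -/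
abbrev DGIdx (N : ℕ) := Fin N × Fin 3

/-- Dead-zone nonlinearity of the saturation with limits `lo`, `hi`: `sat(u) = u + φ(u)`. -/
def deadZone (lo hi u : ℝ) : ℝ :=
  if hi < u then hi - u else if u < lo then lo - u else 0

namespace Microgrid

variable {N L : ℕ} (G : Microgrid N L)

/-- index set of the consolidated performance output `z_c` -/
abbrev OutIdx := (Σ i, Fin (G.m i)) ⊕ (Σ l, Fin (G.mbar l))

/-- signed incidence (bi-adjacency) matrix of the physical topology -/
def B : Matrix (Fin N) (Fin L) ℝ :=
  Matrix.of fun i l => (if G.src l = i then 1 else 0) - (if G.dst l = i then 1 else 0)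

/-! #### Error subsystems -/

def A (i : Fin N) : Matrix (Fin 3) (Fin 3) ℝ :=
  !![-(G.YL i / G.Ct i), 1 / G.Ct i, 0;
     -(1 / G.Lt i), -(G.Rt i / G.Lt i), 0;
     1, 0, 0]

/-- `B_i` -/
def Bin (i : Fin N) : Fin 3 → ℝ := ![0, 1 / G.Lt i, 0]

/-- `B_i^{aw}` -/
def Baw (i : Fin N) : Fin 3 → ℝ := ![0, 1 / G.Lt i, -G.Kaw i]

/-- `K_{i0}` -/
def K0 (i : Fin N) : Fin 3 → ℝ := ![G.kP i, 0, G.kI i]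

/-- the nonlinearity of the constant power load, in error coordinates -/
def cpl (i : Fin N) (x : Fin 3 → ℝ) : Fin 3 → ℝ :=
  ![(1 / G.Ct i) * (G.PL i / G.Vr i - G.PL i / (x 0 + G.Vr i)), 0, 0]

/-- The converter command `u_i = u_iS + u_iL + u_iG`, with the steady state input
`u_iS = V_ri + R_ti P_ni I_s` and the contribution `uG` of the distributed controller. -/
def command (i : Fin N) (x : Fin 3 → ℝ) (uG : ℝ) : ℝ :=
  (G.Vr i + G.Rt i * G.Pn i * G.Is) + G.K0 i ⬝ᵥ x + uG

/-- Right-hand side of the DG error subsystem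
`ẋ_i = (A_i + B_i K_{i0}) x_i + g_i(x_i) + B_i^{aw} φ_i(u_i) + η_i`. -/
def dgField (i : Fin N) (x η : Fin 3 → ℝ) (uG : ℝ) : Fin 3 → ℝ :=
  (G.A i + Matrix.vecMulVec (G.Bin i) (G.K0 i)) *ᵥ x + G.cpl i x
    + deadZone (G.Vtmin i) (G.Vtmax i) (G.command i x uG) • G.Baw i + η

/-- Right-hand side of the line error subsystem. -/
def lineField (l : Fin L) (x u : ℝ) : ℝ :=
  -(G.Rl l / G.Ll l) * x + G.lineGain l * u

/-- The DG error subsystem `η_i ↦ x_i` is IF-OFP(`ν`,`ρ`) on the operating range: states in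
`𝒳`, arbitrary `η_i`, and the distributed contribution `u_iG` treated as an unknown with
`|u_iG| ≤ δ`. -/
def DGPassive (i : Fin N) (𝒳 : Set (Fin 3 → ℝ)) (δ ν ρ : ℝ) : Prop :=
  DissipativeOn {p : (Fin 3 → ℝ) × ((Fin 3 → ℝ) × ℝ) | p.1 ∈ 𝒳 ∧ |p.2.2| ≤ δ}
    (fun x u => G.dgField i x u.1 u.2) (fun x _ => x)
    (fun u y => ifofpSupply ν ρ u.1 y)

/-- The line error subsystem `u_l ↦ x_l` is IF-OFP(`ν`,`ρ`). -/
def LinePassive (l : Fin L) (ν ρ : ℝ) : Prop :=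
  DissipativeOn (Set.univ : Set (ℝ × ℝ)) (G.lineField l) (fun x _ => x)
    (fun u y => -ν * u ^ 2 + u * y - ρ * y ^ 2)

/-! #### Blocks of the interconnection matrix -/

def Cbar : Matrix (DGIdx N) (Fin L) ℝ :=
  Matrix.of fun a l => if a.2 = 0 then -(1 / G.Ct a.1) * G.B a.1 l else 0

def C : Matrix (Fin L) (DGIdx N) ℝ :=
  Matrix.of fun l a => if a.2 = 0 then G.B a.1 l else 0

/-- `E = diag(E_i)` with `E_i = diag(1/C_ti, 1/L_ti, 1)` -/
def E : Matrix (DGIdx N) (DGIdx N) ℝ :=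
  Matrix.diagonal fun a => ![1 / G.Ct a.1, 1 / G.Lt a.1, 1] a.2

def Ebar : Matrix (Fin L) (Fin L) ℝ := Matrix.diagonal G.lineDist

def Ec : Matrix (DGIdx N) (DGIdx N ⊕ Fin L) ℝ := Matrix.fromCols G.E 0

def Ebarc : Matrix (Fin L) (DGIdx N ⊕ Fin L) ℝ := Matrix.fromCols 0 G.Ebar

/-- `H_c`: block diagonal of the `H_i` on top of a zero block -/
def Hc : Matrix G.OutIdx (DGIdx N) ℝ :=
  Matrix.of fun a b => Sum.elim (fun p => if p.1 = b.1 then G.H p.1 p.2 b.2 else 0)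
    (fun _ => 0) a

/-- `\bar H_c`: block diagonal of the `\bar H_l` below a zero block -/
def Hbarc : Matrix G.OutIdx (Fin L) ℝ :=
  Matrix.of fun a l => Sum.elim (fun _ => 0)
    (fun p => if p.1 = l then G.Hbar p.1 p.2 else 0) a

end Microgrid

/-! ### Distributed consensus controllers and the networked error system -/

/-- A distributed consensus controller: a communication topology, given by the in-neighbours of
every DG, with the gain `k_ij` of every link `j → i`; a link is present exactly where the gain
is not zero. -/
@[ext] structure ConsensusController (N : ℕ) where
  inNbrs : Fin N → Finset (Fin N)
  gain : Fin N → Fin N → ℝ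
  irrefl : ∀ i, i ∉ inNbrs i
  mem_iff : ∀ i j, j ∈ inNbrs i ↔ gain i j ≠ 0

namespace Microgrid

variable {N L : ℕ} (G : Microgrid N L) (c : ConsensusController N)

/-- `u_iG = Σ_{j ∈ F_i⁻} k_ij (I_ti / P_ni - I_tj / P_nj)`, in error coordinates -/
def uG (x : DGIdx N → ℝ) (i : Fin N) : ℝ :=
  ∑ j ∈ c.inNbrs i, c.gain i j * (x (i, 1) / G.Pn i - x (j, 1) / G.Pn j)

/-- the matrix `K_I` of the consensus controller -/
def KI : Matrix (Fin N) (Fin N) ℝ :=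
  Matrix.of fun i j =>
    if i = j then (∑ k ∈ c.inNbrs i, c.gain i k) / G.Pn i
    else if j ∈ c.inNbrs i then -c.gain i j / G.Pn j
    else 0

/-- `K = [K_ij]`, where `K_ij` has the single nonzero entry `[K_I]_ij / L_ti`, in the middle -/
def K : Matrix (DGIdx N) (DGIdx N) ℝ :=
  Matrix.of fun a b => if a.2 = 1 ∧ b.2 = 1 then (1 / G.Lt a.1) * G.KI c a.1 b.1 else 0

/-- states of the networked error system: stacked DG errors and line errors -/
abbrev NetState (N L : ℕ) := (DGIdx N → ℝ) × (Fin L → ℝ)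

/-- Right-hand side of the networked error system: the error subsystems interconnected by
`η = K x + \bar C \bar x + E_c w_c` and `\bar u = C x + \bar E_c w_c`. -/
def netField (s : NetState N L) (w : DGIdx N ⊕ Fin L → ℝ) : NetState N L :=
  let η := G.K c *ᵥ s.1 + G.Cbar *ᵥ s.2 + G.Ec *ᵥ w
  let ubar := G.C *ᵥ s.1 + G.Ebarc *ᵥ w
  (fun a => G.dgField a.1 (fun k => s.1 (a.1, k)) (fun k => η (a.1, k)) (G.uG c s.1 a.1) a.2,
   fun l => G.lineField l (s.2 l) (ubar l))

/-- performance output `z_c = H_c x + \bar H_c \bar x` -/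
def netOutput (s : NetState N L) (_w : DGIdx N ⊕ Fin L → ℝ) : G.OutIdx → ℝ :=
  G.Hc *ᵥ s.1 + G.Hbarc *ᵥ s.2

/-- operating range of the networked error system -/
def netRange (𝒳 : Fin N → Set (Fin 3 → ℝ)) (δ : Fin N → ℝ) :
    Set (NetState N L × (DGIdx N ⊕ Fin L → ℝ)) :=
  {p | ∀ i, (fun k => p.1.1 (i, k)) ∈ 𝒳 i ∧ |G.uG c p.1.1 i| ≤ δ i}

end Microgrid

/-! ### The LMI problem -/

/-- `diag(d_i I_3)` -/
def dgDiag {N : ℕ} (d : Fin N → ℝ) : Matrix (DGIdx N) (DGIdx N) ℝ :=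
  Matrix.diagonal fun a => d a.1

/-- Passivity indices `(ν_i, ρ_i)` of the DGs and `(\bar ν_l, \bar ρ_l)` of the lines. -/
structure Indices (N L : ℕ) where
  ν : Fin N → ℝ
  ρ : Fin N → ℝ
  νbar : Fin L → ℝ
  ρbar : Fin L → ℝ

namespace Indices

variable {N L : ℕ} (J : Indices N L)

def Xp11 (p : Fin N → ℝ) : Matrix (DGIdx N) (DGIdx N) ℝ := dgDiag fun i => -p i * J.ν i
def Xp22 (p : Fin N → ℝ) : Matrix (DGIdx N) (DGIdx N) ℝ := dgDiag fun i => -p i * J.ρ i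
def X12 : Matrix (DGIdx N) (DGIdx N) ℝ := dgDiag fun i => -(1 / (2 * J.ν i))
def X21 : Matrix (DGIdx N) (DGIdx N) ℝ := J.X12ᵀ
def Xbar11 (q : Fin L → ℝ) : Matrix (Fin L) (Fin L) ℝ := Matrix.diagonal fun l => -q l * J.νbar l
def Xbar22 (q : Fin L → ℝ) : Matrix (Fin L) (Fin L) ℝ := Matrix.diagonal fun l => -q l * J.ρbar l
def Xbar12 : Matrix (Fin L) (Fin L) ℝ := Matrix.diagonal fun l => -(1 / (2 * J.νbar l))
def Xbar21 : Matrix (Fin L) (Fin L) ℝ := J.Xbar12ᵀ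

end Indices

/-- `Q_I`: the middle entries of the blocks of `Q` -/
def middle {N : ℕ} (Q : Matrix (DGIdx N) (DGIdx N) ℝ) : Matrix (Fin N) (Fin N) ℝ :=
  Matrix.of fun i j => Q (i, 1) (j, 1)

namespace Microgrid

variable {N L : ℕ} (G : Microgrid N L)

/-- index set of the `6 × 6` block matrix `W` -/
abbrev WIdx :=
  (DGIdx N ⊕ (Fin L ⊕ G.OutIdx)) ⊕ (DGIdx N ⊕ (Fin L ⊕ (DGIdx N ⊕ Fin L)))

/-- upper left `3 × 3` blocks of `W` -/
def WA (J : Indices N L) (p : Fin N → ℝ) (q : Fin L → ℝ) :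
    Matrix (DGIdx N ⊕ (Fin L ⊕ G.OutIdx)) (DGIdx N ⊕ (Fin L ⊕ G.OutIdx)) ℝ :=
  fromBlocks (J.Xp11 p) 0 0 (fromBlocks (J.Xbar11 q) 0 0 1)

/-- upper right `3 × 3` blocks of `W` -/
def WB (J : Indices N L) (Q : Matrix (DGIdx N) (DGIdx N) ℝ) (p : Fin N → ℝ) (q : Fin L → ℝ) :
    Matrix (DGIdx N ⊕ (Fin L ⊕ G.OutIdx)) (DGIdx N ⊕ (Fin L ⊕ (DGIdx N ⊕ Fin L))) ℝ :=
  fromRows (fromCols Q (fromCols (J.Xp11 p * G.Cbar) (J.Xp11 p * G.Ec)))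
    (fromRows (fromCols (J.Xbar11 q * G.C) (fromCols 0 (J.Xbar11 q * G.Ebarc)))
      (fromCols G.Hc (fromCols G.Hbarc 0)))

/-- lower right `3 × 3` blocks of `W` -/
def WD (J : Indices N L) (Q : Matrix (DGIdx N) (DGIdx N) ℝ) (p : Fin N → ℝ) (q : Fin L → ℝ)
    (γt : ℝ) :
    Matrix (DGIdx N ⊕ (Fin L ⊕ (DGIdx N ⊕ Fin L))) (DGIdx N ⊕ (Fin L ⊕ (DGIdx N ⊕ Fin L))) ℝ :=
  fromRows
    (fromCols (-(Qᵀ * J.X12) - J.X21 * Q - J.Xp22 p)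
      (fromCols (-(J.X21 * J.Xp11 p * G.Cbar) - G.Cᵀ * J.Xbar11 q * J.Xbar12)
        (-(J.X21 * J.Xp11 p * G.Ec))))
    (fromRows
      (fromCols (-(G.Cbarᵀ * J.Xp11 p * J.X12) - J.Xbar21 * J.Xbar11 q * G.C)
        (fromCols (-(J.Xbar22 q)) (-(J.Xbar21 * J.Xbar11 q * G.Ebarc))))
      (fromCols (-(G.Ecᵀ * J.Xp11 p * J.X12))
        (fromCols (-(G.Ebarcᵀ * J.Xbar11 q * J.Xbar12)) (γt • 1))))

/-- The matrix `W` of the co-design problem. -/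
def W (J : Indices N L) (Q : Matrix (DGIdx N) (DGIdx N) ℝ) (p : Fin N → ℝ) (q : Fin L → ℝ)
    (γt : ℝ) : Matrix G.WIdx G.WIdx ℝ :=
  fromBlocks (G.WA J p q) (G.WB J Q p q) (G.WB J Q p q)ᵀ (G.WD J Q p q γt)

/-- Feasible points `(Q, p, \bar p, \tilde γ, S)` of the co-design LMI problem with the bounds
`γbar` on the squared gain and `ηS` on the trace of the slack matrix. -/
structure LMIFeasible (J : Indices N L) (γbar ηS : ℝ)
    (Q : Matrix (DGIdx N) (DGIdx N) ℝ) (p : Fin N → ℝ) (q : Fin L → ℝ) (γt : ℝ)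
    (S : Matrix G.WIdx G.WIdx ℝ) : Prop where
  p_pos : ∀ i, 0 < p i
  q_pos : ∀ l, 0 < q l
  /-- only the middle entry of a block of `Q` may be nonzero -/
  structured : ∀ a b, ¬(a.2 = 1 ∧ b.2 = 1) → Q a b = 0
  /-- the dissipativity certificate `W > 0`; the slack may not be used to violate it -/
  W_pos : (G.W J Q p q γt).PosDef
  WS_pos : (G.W J Q p q γt + S).PosDef
  S_nonneg : S.PosSemidef
  S_trace : S.trace ≤ ηS
  gain_pos : 0 < γt
  gain_lt : γt < γbar
  /-- weighted Laplacian constraint `Q_I P_n 1 = 0` -/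
  laplacian : (middle Q * Matrix.diagonal G.Pn) *ᵥ 1 = 0

end Microgrid

end DCMG

end

theorem LipschitzOnWith.comp_absolutelyContinuousOnInterval {X Y : Type*}
    [PseudoMetricSpace X] [PseudoMetricSpace Y] {V : X → Y} {x : ℝ → X} {a b : ℝ} {s : Set X}
    {k : NNReal} (hV : LipschitzOnWith k V s) (hx : AbsolutelyContinuousOnInterval x a b)
    (hs : Set.MapsTo x (Set.uIcc a b) s) :
    AbsolutelyContinuousOnInterval (fun t => V (x t)) a b := by
  rw [absolutelyContinuousOnInterval_iff] at hx ⊢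
  intro ε hε
  obtain ⟨δ, hδ, h⟩ := hx (ε / (k + 1)) (by positivity)
  refine ⟨δ, hδ, fun E hE hlt => ?_⟩
  calc ∑ i ∈ Finset.range E.1, dist (V (x (E.2 i).1)) (V (x (E.2 i).2))
      ≤ ∑ i ∈ Finset.range E.1, k * dist (x (E.2 i).1) (x (E.2 i).2) :=
        Finset.sum_le_sum fun i hi =>
          hV.dist_le_mul _ (hs (hE.1 i hi).1) _ (hs (hE.1 i hi).2)
    _ = k * ∑ i ∈ Finset.range E.1, dist (x (E.2 i).1) (x (E.2 i).2) := (Finset.mul_sum _ _ _).symm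
    _ ≤ k * (ε / (k + 1)) := by gcongr; exact (h E hE hlt).le
    _ < (k + 1) * (ε / (k + 1)) := by gcongr; linarith
    _ = ε := by field

theorem ContDiff.comp_absolutelyContinuousOnInterval {X : Type*} [NormedAddCommGroup X]
    [NormedSpace ℝ X] {V : X → ℝ} (hV : ContDiff ℝ 1 V) {x : ℝ → X} {a b : ℝ}
    (hx : AbsolutelyContinuousOnInterval x a b) :
    AbsolutelyContinuousOnInterval (fun t => V (x t)) a b := by
  obtain ⟨k, hk⟩ := (hV.locallyLipschitz.locallyLipschitzOn (s := x '' Set.uIcc a b)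
    ).exists_lipschitzOnWith_of_compact (isCompact_uIcc.image_of_continuousOn hx.continuousOn)
  exact hk.comp_absolutelyContinuousOnInterval hx (Set.mapsTo_image _ _)

theorem MeasureTheory.MemLp.integrable_dotProduct_self {α ι : Type*} [MeasurableSpace α]
    [Fintype ι] {μ : Measure α} {w : α → ι → ℝ} (hw : MemLp w 2 μ) :
    Integrable (fun t => w t ⬝ᵥ w t) μ := by
  refine integrable_finsetSum _ fun i _ => ?_
  have hi : MemLp (fun t => w t i) 2 μ := hw.eval i
  simpa [pow_two] using hi.integrable_sq

namespace DCMG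

theorem DissipativeOn.hasFiniteL2GainOn {X ι κ : Type*} [NormedAddCommGroup X] [NormedSpace ℝ X]
    [Fintype ι] [Fintype κ] {D : Set (X × (ι → ℝ))} {f : X → (ι → ℝ) → X} {h : X → κ → ℝ}
    {γ : ℝ} (hh : Continuous h) (hD : DissipativeOn D f (fun x _ => h x) (l2Supply γ)) :
    HasFiniteL2GainOn D f (fun x _ => h x) γ := by
  obtain ⟨V, hV, hV0, hVpos, hdiss⟩ := hD
  have hVnn : ∀ x, 0 ≤ V x := fun x => by
    by_cases hx : x = 0
    · simp [hx, hV0]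
    · exact (hVpos x hx).le
  refine ⟨V, hVnn, hV0, fun T w x hT hw htr => ?_⟩
  have hac := hV.comp_absolutelyContinuousOnInterval htr.absCont
  have hxc : ContinuousOn x (Set.Icc 0 T) := by
    simpa [Set.uIcc_of_le hT] using htr.absCont.continuousOn
  have hz : IntegrableOn (fun t => h (x t) ⬝ᵥ h (x t)) (Set.Icc 0 T) := by
    refine ContinuousOn.integrableOn_Icc ?_
    exact (Continuous.dotProduct hh hh).comp_continuousOn hxc
  have hw2 : IntegrableOn (fun t => w t ⬝ᵥ w t) (Set.Icc 0 T) := hw.integrable_dotProduct_self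
  have hd : IntegrableOn (deriv fun t => V (x t)) (Set.Icc 0 T) := by
    rw [integrableOn_Icc_iff_integrableOn_Ioc]
    exact (intervalIntegrable_iff_integrableOn_Ioc_of_le hT).1 hac.intervalIntegrable_deriv
  have hftc : ∫ t in Set.Icc 0 T, deriv (fun t => V (x t)) t = V (x T) - V (x 0) := by
    rw [integral_Icc_eq_integral_Ioc, ← intervalIntegral.integral_of_le hT,
      hac.integral_deriv_eq_sub]
  have hle : ∫ t in Set.Icc 0 T, deriv (fun t => V (x t)) t ≤
      ∫ t in Set.Icc 0 T, (γ ^ 2 * (w t ⬝ᵥ w t) - h (x t) ⬝ᵥ h (x t)) := by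
    refine integral_mono_ae hd ((hw2.const_mul _).sub hz) ?_
    filter_upwards [htr.ode, ae_restrict_mem measurableSet_Icc] with t ht hmem
    have hVt := (hV.differentiable one_ne_zero (x t)).hasFDerivAt.comp_hasDerivAt t ht
    rw [show deriv (fun t => V (x t)) t = _ from hVt.deriv]
    exact hdiss _ _ (htr.mem t hmem)
  rw [integral_sub (hw2.const_mul _) hz, integral_const_mul, hftc] at hle
  linarith [hVnn (x T)]

theorem dotProduct_transpose_mulVec {m n : Type*} [Fintype m] [Fintype n] (M : Matrix m n ℝ)
    (x : n → ℝ) (y : m → ℝ) : x ⬝ᵥ (Mᵀ *ᵥ y) = (M *ᵥ x) ⬝ᵥ y := by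
  rw [dotProduct_mulVec, vecMul_transpose]

theorem dotProduct_dgDiag_mulVec {N : ℕ} (d : Fin N → ℝ) (x y : DGIdx N → ℝ) :
    x ⬝ᵥ (dgDiag d *ᵥ y) = ∑ i, d i * ((fun k => x (i, k)) ⬝ᵥ fun k => y (i, k)) := by
  simp only [dotProduct, dgDiag, mulVec_diagonal, Fintype.sum_prod_type, Finset.mul_sum]
  exact Finset.sum_congr rfl fun i _ => Finset.sum_congr rfl fun k _ => by ring

theorem dotProduct_diagonal_mulVec {n : Type*} [Fintype n] [DecidableEq n] (d x y : n → ℝ) :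
    x ⬝ᵥ (diagonal d *ᵥ y) = ∑ l, d l * (x l * y l) := by
  simp only [dotProduct, mulVec_diagonal]
  exact Finset.sum_congr rfl fun i _ => by ring

theorem mul_diagonal_mulVec_one_apply {m n : Type*} [Fintype n] [DecidableEq n]
    (M : Matrix m n ℝ) (d : n → ℝ) (i : m) : ((M * diagonal d) *ᵥ 1) i = ∑ j, M i j * d j := by
  simp [mulVec, dotProduct, mul_diagonal]

namespace Microgrid

variable {N L : ℕ} {G : Microgrid N L} {J : Indices N L} {γbar ηS : ℝ}
  {Q : Matrix (DGIdx N) (DGIdx N) ℝ} {p : Fin N → ℝ} {q : Fin L → ℝ} {γt : ℝ}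
  {S : Matrix G.WIdx G.WIdx ℝ}

theorem LMIFeasible.neg_p_mul_ν_pos (h : G.LMIFeasible J γbar ηS Q p q γt S) (i : Fin N) :
    0 < -p i * J.ν i := by
  simpa [W, WA, Indices.Xp11, dgDiag] using h.W_pos.diag_pos (i := Sum.inl (Sum.inl (i, 0)))

theorem LMIFeasible.neg_q_mul_νbar_pos (h : G.LMIFeasible J γbar ηS Q p q γt S) (l : Fin L) :
    0 < -q l * J.νbar l := by
  simpa [W, WA, Indices.Xbar11] using h.W_pos.diag_pos (i := Sum.inl (Sum.inr (Sum.inl l)))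

theorem LMIFeasible.ν_ne_zero (h : G.LMIFeasible J γbar ηS Q p q γt S) (i : Fin N) :
    J.ν i ≠ 0 := right_ne_zero_of_mul (h.neg_p_mul_ν_pos i).ne'

theorem LMIFeasible.νbar_ne_zero (h : G.LMIFeasible J γbar ηS Q p q γt S) (l : Fin L) :
    J.νbar l ≠ 0 := right_ne_zero_of_mul (h.neg_q_mul_νbar_pos l).ne'

theorem LMIFeasible.Xp11_mul_dgDiag (h : G.LMIFeasible J γbar ηS Q p q γt S) :
    J.Xp11 p * dgDiag (fun i => (-p i * J.ν i)⁻¹) = 1 := by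
  rw [Indices.Xp11, dgDiag, dgDiag, diagonal_mul_diagonal, ← diagonal_one]
  exact congrArg _ (funext fun a => mul_inv_cancel₀ (h.neg_p_mul_ν_pos a.1).ne')

theorem LMIFeasible.Xp11_inv (h : G.LMIFeasible J γbar ηS Q p q γt S) :
    (J.Xp11 p)⁻¹ = dgDiag fun i => (-p i * J.ν i)⁻¹ :=
  inv_eq_right_inv h.Xp11_mul_dgDiag

theorem LMIFeasible.Xp11_mul_inv_mul (h : G.LMIFeasible J γbar ηS Q p q γt S) :
    J.Xp11 p * ((J.Xp11 p)⁻¹ * Q) = Q := by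
  rw [h.Xp11_inv, ← Matrix.mul_assoc, h.Xp11_mul_dgDiag, Matrix.one_mul]

/-- The Schur complement of `W` as an inequality between supply rates. -/
theorem LMIFeasible.sum_supply_le (h : G.LMIFeasible J γbar ηS Q p q γt S)
    {M : Matrix (DGIdx N) (DGIdx N) ℝ} (hM : J.Xp11 p * M = Q)
    (x : DGIdx N → ℝ) (xb : Fin L → ℝ) (w : DGIdx N ⊕ Fin L → ℝ)
    {η : DGIdx N → ℝ} {ub : Fin L → ℝ} {z : G.OutIdx → ℝ}
    (hη : η = M *ᵥ x + G.Cbar *ᵥ xb + G.Ec *ᵥ w) (hub : ub = G.C *ᵥ x + G.Ebarc *ᵥ w)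
    (hz : z = G.Hc *ᵥ x + G.Hbarc *ᵥ xb) :
    ∑ i, p i * ifofpSupply (J.ν i) (J.ρ i) (fun k => η (i, k)) (fun k => x (i, k)) +
      ∑ l, q l * (-J.νbar l * ub l ^ 2 + ub l * xb l - J.ρbar l * xb l ^ 2) ≤
    γt * (w ⬝ᵥ w) - z ⬝ᵥ z := by
  have hp : ∑ i, p i * ifofpSupply (J.ν i) (J.ρ i) (fun k => η (i, k)) (fun k => x (i, k)) =
      η ⬝ᵥ (J.Xp11 p *ᵥ η) + 2 * ((J.X12 *ᵥ x) ⬝ᵥ (J.Xp11 p *ᵥ η)) + x ⬝ᵥ (J.Xp22 p *ᵥ x) := by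
    rw [Indices.Xp11, Indices.Xp22, dotProduct_dgDiag_mulVec, dotProduct_dgDiag_mulVec,
      dotProduct_dgDiag_mulVec, Finset.mul_sum, ← Finset.sum_add_distrib,
      ← Finset.sum_add_distrib]
    refine Finset.sum_congr rfl fun i _ => ?_
    have hν := h.ν_ne_zero i
    rw [ifofpSupply, show (fun k => (J.X12 *ᵥ x) (i, k)) =
      (-(1 / (2 * J.ν i))) • fun k => x (i, k) from
        funext fun k => by simp [Indices.X12, dgDiag, mulVec_diagonal], smul_dotProduct,
      smul_eq_mul, dotProduct_comm (fun k => x (i, k)) (fun k => η (i, k))]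
    field
  have hq : ∑ l, q l * (-J.νbar l * ub l ^ 2 + ub l * xb l - J.ρbar l * xb l ^ 2) =
      ub ⬝ᵥ (J.Xbar11 q *ᵥ ub) + 2 * ((J.Xbar12 *ᵥ xb) ⬝ᵥ (J.Xbar11 q *ᵥ ub)) +
        xb ⬝ᵥ (J.Xbar22 q *ᵥ xb) := by
    rw [Indices.Xbar11, Indices.Xbar22, dotProduct_diagonal_mulVec, dotProduct_diagonal_mulVec,
      dotProduct_diagonal_mulVec, Finset.mul_sum, ← Finset.sum_add_distrib,
      ← Finset.sum_add_distrib]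
    refine Finset.sum_congr rfl fun l _ => ?_
    have hν := h.νbar_ne_zero l
    rw [Indices.Xbar12, mulVec_diagonal]
    field
  have hX : ∀ u v : DGIdx N → ℝ, u ⬝ᵥ (J.Xp11 p *ᵥ v) = (J.Xp11 p *ᵥ u) ⬝ᵥ v := fun u v => by
    conv_lhs => rw [show J.Xp11 p = (J.Xp11 p)ᵀ from (diagonal_transpose _).symm]
    rw [dotProduct_transpose_mulVec]
  have hXb : ∀ u v : Fin L → ℝ, u ⬝ᵥ (J.Xbar11 q *ᵥ v) = (J.Xbar11 q *ᵥ u) ⬝ᵥ v := fun u v => by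
    conv_lhs => rw [show J.Xbar11 q = (J.Xbar11 q)ᵀ from (diagonal_transpose _).symm]
    rw [dotProduct_transpose_mulVec]
  have key := h.W_pos.posSemidef.dotProduct_mulVec_nonneg
    (Sum.elim (Sum.elim (-η) (Sum.elim (-ub) (-z))) (Sum.elim x (Sum.elim xb w)))
  have hA : G.WA J p q *ᵥ Sum.elim (-η) (Sum.elim (-ub) (-z)) =
      Sum.elim (-(J.Xp11 p *ᵥ η)) (Sum.elim (-(J.Xbar11 q *ᵥ ub)) (-z)) := by
    simp [WA, fromBlocks_mulVec, mulVec_neg]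
  have hB : G.WB J Q p q *ᵥ Sum.elim x (Sum.elim xb w) =
      Sum.elim (J.Xp11 p *ᵥ η) (Sum.elim (J.Xbar11 q *ᵥ ub) z) := by
    rw [WB, fromRows_mulVec, fromRows_mulVec]
    simp only [fromCols_mulVec_sumElim, ← hM, hη, hub, hz, mulVec_add, mulVec_mulVec, add_assoc,
      zero_mulVec, zero_add, add_zero]
  have hD : Sum.elim x (Sum.elim xb w) ⬝ᵥ (G.WD J Q p q γt *ᵥ Sum.elim x (Sum.elim xb w)) =
      γt * (w ⬝ᵥ w) - 2 * ((J.X12 *ᵥ x) ⬝ᵥ (J.Xp11 p *ᵥ η))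
        - 2 * ((J.Xbar12 *ᵥ xb) ⬝ᵥ (J.Xbar11 q *ᵥ ub))
        - x ⬝ᵥ (J.Xp22 p *ᵥ x) - xb ⬝ᵥ (J.Xbar22 q *ᵥ xb) := by
    rw [WD, fromRows_mulVec, fromRows_mulVec]
    simp only [fromCols_mulVec_sumElim, sumElim_dotProduct_sumElim, sub_mulVec, neg_mulVec,
      dotProduct_add, dotProduct_sub, dotProduct_neg, ← mulVec_mulVec, smul_mulVec, one_mulVec,
      dotProduct_smul, smul_eq_mul, dotProduct_transpose_mulVec, Indices.X21, Indices.Xbar21,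
      ← hM, hη, hub, mulVec_add, transpose_mul]
    rw [hX (G.Cbar *ᵥ xb), hX (G.Ec *ᵥ w), hXb (G.C *ᵥ x), hXb (G.Ebarc *ᵥ w)]
    simp only [dotProduct_comm _ (J.X12 *ᵥ x), dotProduct_comm _ (J.Xbar12 *ᵥ xb)]
    ring
  rw [W, fromBlocks_mulVec, star_trivial, Sum.elim_comp_inl, Sum.elim_comp_inr,
    sumElim_dotProduct_sumElim, dotProduct_add,
    dotProduct_add, dotProduct_transpose_mulVec, hA, hB, hD] at key
  simp only [sumElim_dotProduct_sumElim, neg_dotProduct, dotProduct_neg, neg_neg] at key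
  rw [hp, hq]
  rw [hX η η, hXb ub ub] at *
  linarith

end Microgrid

namespace ConsensusController

variable {N : ℕ}

/-- The consensus controller with the off-diagonal gains `g`. -/
noncomputable def ofGain (g : Fin N → Fin N → ℝ) : ConsensusController N where
  inNbrs i := {j | i ≠ j ∧ g i j ≠ 0}
  gain i j := if i = j then 0 else g i j
  irrefl i := by simp
  mem_iff i j := by simp

theorem gain_self (c : ConsensusController N) (i : Fin N) : c.gain i i = 0 :=
  not_not.1 fun h => c.irrefl i ((c.mem_iff i i).2 h)

theorem sum_inNbrs (c : ConsensusController N) (i : Fin N) (f : Fin N → ℝ) :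
    ∑ j ∈ c.inNbrs i, c.gain i j * f j = ∑ j, c.gain i j * f j := by
  refine Finset.sum_subset (Finset.subset_univ _) fun j _ hj => ?_
  rw [c.mem_iff, not_not] at hj
  rw [hj, zero_mul]

end ConsensusController

namespace Microgrid

variable {N L : ℕ} (G : Microgrid N L)

theorem KI_apply_of_ne (c : ConsensusController N) {i j : Fin N} (hij : i ≠ j) :
    G.KI c i j = -c.gain i j / G.Pn j := by
  by_cases hj : j ∈ c.inNbrs i
  · simp [KI, hij, hj]
  · have hg : c.gain i j = 0 := by simpa [c.mem_iff] using hj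
    simp [KI, hij, hj, hg]

theorem KI_apply_self (c : ConsensusController N) (i : Fin N) :
    G.KI c i i = (∑ k, c.gain i k) / G.Pn i := by
  have h := c.sum_inNbrs i fun _ => 1
  simp only [mul_one] at h
  simp [KI, h]

theorem KI_eq_middle_K (c : ConsensusController N) (i j : Fin N) :
    G.KI c i j = G.Lt i * middle (G.K c) i j := by
  have := (G.Lt_pos i).ne'
  simp only [middle, K, of_apply, and_self, if_true]
  field

theorem KI_mul_Pn_mulVec_one (c : ConsensusController N) :
    (G.KI c * Matrix.diagonal G.Pn) *ᵥ 1 = 0 := by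
  funext i
  rw [mul_diagonal_mulVec_one_apply, Pi.zero_apply,
    ← Finset.add_sum_erase _ _ (Finset.mem_univ i), KI_apply_self,
    div_mul_cancel₀ _ (G.Pn_pos i).ne', ← Finset.add_sum_erase _ _ (Finset.mem_univ i),
    c.gain_self, zero_add, ← Finset.sum_add_distrib]
  refine Finset.sum_eq_zero fun j hj => ?_
  have := (G.Pn_pos j).ne'
  rw [KI_apply_of_ne G c (Finset.ne_of_mem_erase hj).symm]
  field

/-- The gains of a consensus controller are determined by its gain matrix. -/
theorem K_injective : Function.Injective G.K := by
  intro c c' h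
  have hgain : c.gain = c'.gain := by
    funext i j
    by_cases hij : i = j
    · rw [hij, c.gain_self, c'.gain_self]
    · have hKI : G.KI c i j = G.KI c' i j := by rw [KI_eq_middle_K, KI_eq_middle_K, h]
      rw [KI_apply_of_ne G c hij, KI_apply_of_ne G c' hij,
        div_left_inj' (G.Pn_pos j).ne', neg_inj] at hKI
      exact hKI
  ext i j
  · rw [c.mem_iff, c'.mem_iff, hgain]
  · rw [hgain]

/-- The consensus controller recovered from the off-diagonal blocks of a gain matrix `M`. -/
noncomputable def controllerOf (M : Matrix (DGIdx N) (DGIdx N) ℝ) : ConsensusController N :=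
  ConsensusController.ofGain fun i j => -(G.Lt i * G.Pn j * middle M i j)

theorem controllerOf_gain_of_ne (M : Matrix (DGIdx N) (DGIdx N) ℝ) {i j : Fin N} (hij : i ≠ j) :
    (G.controllerOf M).gain i j = -(G.Lt i * G.Pn j * middle M i j) := by
  simp [controllerOf, ConsensusController.ofGain, hij]

theorem mem_controllerOf_inNbrs {M : Matrix (DGIdx N) (DGIdx N) ℝ}
    (hM : ∀ a b, ¬(a.2 = 1 ∧ b.2 = 1) → M a b = 0) (i j : Fin N) :
    j ∈ (G.controllerOf M).inNbrs i ↔ i ≠ j ∧ ∃ k k', M (i, k) (j, k') ≠ 0 := by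
  have hL := (G.Lt_pos i).ne'
  have hP := (G.Pn_pos j).ne'
  simp only [controllerOf, ConsensusController.ofGain, Finset.mem_filter, Finset.mem_univ,
    true_and, ne_eq, neg_eq_zero, mul_eq_zero, hL, hP, false_or, middle, of_apply]
  refine and_congr_right fun _ => ⟨fun h => ⟨1, 1, h⟩, fun ⟨k, k', h⟩ => ?_⟩
  by_contra h0
  by_cases hk : k = 1 ∧ k' = 1
  · exact h (by rw [hk.1, hk.2, h0])
  · exact h (hM _ _ hk)

theorem K_controllerOf {M : Matrix (DGIdx N) (DGIdx N) ℝ}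
    (hM : ∀ a b, ¬(a.2 = 1 ∧ b.2 = 1) → M a b = 0)
    (hlap : (middle M * Matrix.diagonal G.Pn) *ᵥ 1 = 0) : G.K (G.controllerOf M) = M := by
  ext ⟨i, k⟩ ⟨j, k'⟩
  by_cases hk : k = 1 ∧ k' = 1
  swap
  · rw [hM _ _ hk]
    simp [K, hk]
  obtain ⟨rfl, rfl⟩ := hk
  have hL := (G.Lt_pos i).ne'
  have hP := (G.Pn_pos j).ne'
  suffices h : G.KI (G.controllerOf M) i j = G.Lt i * M (i, 1) (j, 1) by
    simp only [K, of_apply, and_self, if_true, h]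
    field
  by_cases hij : i = j
  · subst hij
    have hrow := congrFun hlap i
    rw [mul_diagonal_mulVec_one_apply, Pi.zero_apply,
      ← Finset.add_sum_erase _ _ (Finset.mem_univ i)] at hrow
    have hsum : ∑ j ∈ Finset.univ.erase i, (G.controllerOf M).gain i j =
        -(G.Lt i * ∑ j ∈ Finset.univ.erase i, middle M i j * G.Pn j) := by
      rw [Finset.mul_sum, ← Finset.sum_neg_distrib]
      refine Finset.sum_congr rfl fun j hj => ?_
      rw [controllerOf_gain_of_ne G M (Finset.ne_of_mem_erase hj).symm]
      ring
    rw [KI_apply_self, ← Finset.add_sum_erase _ _ (Finset.mem_univ i),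
      ConsensusController.gain_self, zero_add, hsum, eq_neg_of_add_eq_zero_right hrow]
    simp only [middle, of_apply]
    field
  · rw [KI_apply_of_ne G _ hij, controllerOf_gain_of_ne G M hij]
    simp only [middle, of_apply]
    field

theorem dissipativeOn_net {J : Indices N L} {𝒳 : Fin N → Set (Fin 3 → ℝ)} {δ : Fin N → ℝ}
    (hDG : ∀ i, G.DGPassive i (𝒳 i) (δ i) (J.ν i) (J.ρ i))
    (hLine : ∀ l, G.LinePassive l (J.νbar l) (J.ρbar l))
    {γbar ηS : ℝ} {Q : Matrix (DGIdx N) (DGIdx N) ℝ} {p : Fin N → ℝ} {q : Fin L → ℝ} {γt : ℝ}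
    {S : Matrix G.WIdx G.WIdx ℝ} (h : G.LMIFeasible J γbar ηS Q p q γt S)
    {c : ConsensusController N} (hc : G.K c = (J.Xp11 p)⁻¹ * Q) :
    DissipativeOn (G.netRange c 𝒳 δ) (G.netField c) G.netOutput (l2Supply (Real.sqrt γt)) := by
  choose V hV hV0 hVpos hVd using hDG
  choose U hU hU0 hUpos hUd using hLine
  have hVnn : ∀ i x, 0 ≤ V i x := fun i x => by
    by_cases hx : x = 0
    · simp [hx, hV0]
    · exact (hVpos i x hx).le
  have hUnn : ∀ l x, 0 ≤ U l x := fun l x => by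
    by_cases hx : x = 0
    · simp [hx, hU0]
    · exact (hUpos l x hx).le
  let a (i : Fin N) : NetState N L →L[ℝ] (Fin 3 → ℝ) :=
    ContinuousLinearMap.pi fun k =>
      (ContinuousLinearMap.proj (R := ℝ) (φ := fun _ : DGIdx N => ℝ) (i, k)).comp
        (ContinuousLinearMap.fst ℝ _ _)
  let b (l : Fin L) : NetState N L →L[ℝ] ℝ :=
    (ContinuousLinearMap.proj (R := ℝ) (φ := fun _ : Fin L => ℝ) l).comp
        (ContinuousLinearMap.snd ℝ _ _)
  refine ⟨fun s => ∑ i, p i * V i (a i s) + ∑ l, q l * U l (b l s), ?_, ?_, ?_, ?_⟩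
  · exact (ContDiff.sum fun i _ => contDiff_const.mul ((hV i).comp (a i).contDiff)).add
      (ContDiff.sum fun l _ => contDiff_const.mul ((hU l).comp (b l).contDiff))
  · simp [hV0, hU0]
  · rintro s hs
    have hp : ∀ i, 0 ≤ p i * V i (a i s) := fun i => mul_nonneg (h.p_pos i).le (hVnn _ _)
    have hq : ∀ l, 0 ≤ q l * U l (b l s) := fun l => mul_nonneg (h.q_pos l).le (hUnn _ _)
    by_cases h1 : s.1 = 0
    · have h2 : s.2 ≠ 0 := fun h2 => hs (Prod.ext h1 h2)
      obtain ⟨l, hl⟩ := Function.ne_iff.1 h2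
      exact add_pos_of_nonneg_of_pos (Finset.sum_nonneg fun i _ => hp i)
        (Finset.sum_pos' (fun l _ => hq l)
          ⟨l, Finset.mem_univ _, mul_pos (h.q_pos l) (hUpos l _ hl)⟩)
    · obtain ⟨⟨i, k⟩, hi⟩ := Function.ne_iff.1 h1
      exact add_pos_of_pos_of_nonneg
        (Finset.sum_pos' (fun i _ => hp i)
          ⟨i, Finset.mem_univ _, mul_pos (h.p_pos i) (hVpos i _ (Function.ne_iff.2 ⟨k, hi⟩))⟩)
        (Finset.sum_nonneg fun l _ => hq l)
  · intro s w hD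
    have hderiv : HasFDerivAt (fun s => ∑ i, p i * V i (a i s) + ∑ l, q l * U l (b l s))
        (∑ i, p i • (fderiv ℝ (V i) (a i s)).comp (a i) +
          ∑ l, q l • (fderiv ℝ (U l) (b l s)).comp (b l)) s :=
      (HasFDerivAt.fun_sum fun i _ =>
        ((((hV i).differentiable one_ne_zero (a i s)).hasFDerivAt.comp s
          (a i).hasFDerivAt).const_mul (p i))).add
      (HasFDerivAt.fun_sum fun l _ =>
        ((((hU l).differentiable one_ne_zero (b l s)).hasFDerivAt.comp s
          (b l).hasFDerivAt).const_mul (q l)))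
    rw [hderiv.fderiv, l2Supply, Real.sq_sqrt h.gain_pos.le]
    simp only [_root_.add_apply, _root_.sum_apply,
      _root_.smul_apply, ContinuousLinearMap.comp_apply, smul_eq_mul]
    refine le_trans (add_le_add
      (Finset.sum_le_sum fun i _ => mul_le_mul_of_nonneg_left ?_ (h.p_pos i).le)
      (Finset.sum_le_sum fun l _ => mul_le_mul_of_nonneg_left ?_ (h.q_pos l).le))
      (h.sum_supply_le (hc ▸ h.Xp11_mul_inv_mul) s.1 s.2 w rfl rfl rfl)
    · exact hVd i (fun k => s.1 (i, k)) (_, G.uG c s.1 i) (hD i)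
    · exact hUd l (s.2 l) _ (Set.mem_univ _)

end Microgrid

end DCMG

theorem mainTheorem1 {N L : ℕ} (G : DCMG.Microgrid N L) (J : DCMG.Indices N L)
    (𝒳 : Fin N → Set (Fin 3 → ℝ)) (δ : Fin N → ℝ)
    (hDG : ∀ i, G.DGPassive i (𝒳 i) (δ i) (J.ν i) (J.ρ i))
    (hLine : ∀ l, G.LinePassive l (J.νbar l) (J.ρbar l))
    (γbar ηS : ℝ)
    (Q : Matrix (DCMG.DGIdx N) (DCMG.DGIdx N) ℝ) (p : Fin N → ℝ) (q : Fin L → ℝ) (γt : ℝ)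
    (S : Matrix G.WIdx G.WIdx ℝ)
    (hLMI : G.LMIFeasible J γbar ηS Q p q γt S) :
    ∃ c : DCMG.ConsensusController N,
      -- `K = (X_p^{11})⁻¹ Q` is the gain matrix of exactly one consensus controller
      G.K c = (J.Xp11 p)⁻¹ * Q ∧
      (∀ c' : DCMG.ConsensusController N, G.K c' = (J.Xp11 p)⁻¹ * Q → c' = c) ∧
      -- its communication links are the nonzero off-diagonal blocks of `K`
      (∀ i j, j ∈ c.inNbrs i ↔
        i ≠ j ∧ ∃ k k', ((J.Xp11 p)⁻¹ * Q) (i, k) (j, k') ≠ 0) ∧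
      -- weighted Laplacian property
      (G.KI c * Matrix.diagonal G.Pn).mulVec 1 = 0 ∧
      -- the closed loop is `L₂`-stable with gain `γ = √γt`, and `γ² < γbar`
      Real.sqrt γt ^ 2 = γt ∧ γt < γbar ∧
      DCMG.DissipativeOn (G.netRange c 𝒳 δ) (G.netField c) G.netOutput
        (DCMG.l2Supply (Real.sqrt γt)) ∧
      DCMG.HasFiniteL2GainOn (G.netRange c 𝒳 δ) (G.netField c) G.netOutput (Real.sqrt γt) := by
  have happ : ∀ a b, ((J.Xp11 p)⁻¹ * Q) a b = (-p a.1 * J.ν a.1)⁻¹ * Q a b := fun a b => by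
    rw [hLMI.Xp11_inv, DCMG.dgDiag, diagonal_mul]
  have hstruct : ∀ a b, ¬(a.2 = 1 ∧ b.2 = 1) → ((J.Xp11 p)⁻¹ * Q) a b = 0 := fun a b hab => by
    rw [happ, hLMI.structured a b hab, mul_zero]
  have hlap : (DCMG.middle ((J.Xp11 p)⁻¹ * Q) * Matrix.diagonal G.Pn) *ᵥ 1 = 0 := by
    funext i
    have hrow := congrFun hLMI.laplacian i
    rw [DCMG.mul_diagonal_mulVec_one_apply, Pi.zero_apply] at hrow ⊢
    simp only [DCMG.middle, of_apply] at hrow ⊢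
    simp only [happ, mul_assoc, ← Finset.mul_sum, hrow, mul_zero]
  have hK := G.K_controllerOf hstruct hlap
  have hdiss := G.dissipativeOn_net hDG hLine hLMI hK
  have hout : Continuous fun s : DCMG.Microgrid.NetState N L => G.Hc *ᵥ s.1 + G.Hbarc *ᵥ s.2 :=
    (continuous_const.matrix_mulVec continuous_fst).add
      (continuous_const.matrix_mulVec continuous_snd)
  exact ⟨_, hK, fun c' hc' => G.K_injective (hc'.trans hK.symm),
    G.mem_controllerOf_inNbrs hstruct, G.KI_mul_Pn_mulVec_one _, Real.sq_sqrt hLMI.gain_pos.le,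
    hLMI.gain_lt, hdiss, DCMG.DissipativeOn.hasFiniteL2GainOn hout hdiss⟩
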